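/- Let $V$ be a vertex operator algebra over $\mathbb{C}$ of CFT type ($V=\bigoplus_{n\ge 0}V_n$, $V_0=\mathbb{C}\mathbf{1}$) which is $C_2$-cofinite, i.e. $V/C_2(V)$ is finite dimensional, where $C_2(V)=\mathrm{span}\{a_{(-2)}b\mid a,b\in V\}$. Let $g$ be an automorphism of $V$ of finite order $|g|$, put $V^r=\{a\in V\mid ga=e^{2\pi i r/|g|}a\}$, and let $W$ be a weak $g$-twisted $V$-module generated by one element $w$, i.e. $W=V\cdot w=\mathrm{span}\{a_{(n)}w\mid a\in V,\ n\in\frac1{|g|}\mathbb{Z}\}$. By a monomial we mean a word $X=x^1(m_1)\cdots x^k(m_k)$, $k\ge 0$, where each $x^i$ is homogeneous of weight $\mathrm{wt}(x^i)$ and lies in some $V^{r_i}$ with $m_i\in\frac{r_i}{|g|}+\mathbb{Z}$. Put $\deg X=\sum_i\mathrm{wt}(x^i)$, $\mathrm{wt}\,X=\sum_i(\mathrm{wt}(x^i)-m_i-1)$ and $\phi_w(X)=x^1_{(m_1)}\cdots x^k_{(m_k)}w\in W$. (a) There is a finite-dimensional subspace $U\subseteq V$, stable under $L(0)$ and $g$,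 with $V=U+C_2(V)$. (b) For every such $U$ there is $T\in\frac1{|g|}\mathbb{N}$ such that $\beta_{(m)}w=0$ for all $\beta\in U$ and $m\ge T$. (c) For every such $U$ and every $T\in\frac1{|g|}\mathbb{Z}$ such that $\beta_{(m)}w=0$ for all $\beta\in U$ and $m\ge T$, and for every monomial $X$, the vector $\phi_w(X)$ is a linear combination of vectors $\phi_w(Z)$, where $Z=\alpha^1(n_1)\cdots\alpha^s(n_s)$ are monomials with $\alpha^1,\dots,\alpha^s\in U$, $n_1<\cdots<n_s<T$, $\deg Z\le\deg X$ and $\mathrm{wt}\,Z=\mathrm{wt}\,X$. In particular, $W$ is spanned by the vectors $\alpha^1_{(n_1)}\cdots\alpha^s_{(n_s)}w$ with $s\ge 0$, $\alpha^i\in U$ and $n_1<\cdots<n_s<T$. -/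

import Mathlib

noncomputable section

/-- A vertex operator algebra over `ℂ` with underlying vector space `V`.  The state-field map is
`Y a = ∑ₙ a₍ₙ₎ z⁻ⁿ⁻¹`, and `VertexOperator.ncoeff (Y a) n` is the mode `a₍ₙ₎`.  That each `Y a b`
is a Laurent series (`a₍ₙ₎ b = 0` for large `n`) is part of Mathlib's `VertexOperator`.
`L(n) = ω₍ₙ₊₁₎`, and the weight space `V_n` is the eigenspace of `L(0)` with eigenvalue `n`. -/
structure VertexOperatorAlgebra (V : Type*) [AddCommGroup V] [Module ℂ V] where
  /-- the state-field correspondence -/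
  Y : V →ₗ[ℂ] VertexOperator ℂ V
  /-- the vacuum vector -/
  vacuum : V
  /-- the conformal (Virasoro) vector -/
  omega : V
  /-- the central charge -/
  charge : ℂ
  /-- `Y(𝟙, z) = id` -/
  vacuum_mode : ∀ (n : ℤ) (b : V),
    VertexOperator.ncoeff (Y vacuum) n b = if n = -1 then b else 0
  /-- `Y(a, z) 𝟙` has no negative powers of `z` -/
  creation_nonneg : ∀ (a : V) (n : ℤ), 0 ≤ n → VertexOperator.ncoeff (Y a) n vacuum = 0
  /-- the constant term of `Y(a, z) 𝟙` is `a` -/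
  creation : ∀ a : V, VertexOperator.ncoeff (Y a) (-1) vacuum = a
  /-- The Jacobi identity: the coefficient of `z₀^(-l-1) z₁^(-m-1) z₂^(-n-1)`, applied to `v`.
  All three sums have only finitely many nonzero terms. -/
  jacobi : ∀ (a b v : V) (l m n : ℤ),
    (∑ᶠ i : ℕ, ((-1 : ℂ) ^ i * ((Ring.choose l i : ℤ) : ℂ)) •
      (VertexOperator.ncoeff (Y a) (l + m - i) (VertexOperator.ncoeff (Y b) (n + i) v)
        - (-1 : ℂ) ^ l •
          VertexOperator.ncoeff (Y b) (l + n - i) (VertexOperator.ncoeff (Y a) (m + i) v)))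
    = ∑ᶠ i : ℕ, ((Ring.choose m i : ℤ) : ℂ) •
        VertexOperator.ncoeff (Y (VertexOperator.ncoeff (Y a) (l + i) b)) (m + n - i) v
  /-- the Virasoro relations -/
  virasoro : ∀ (m n : ℤ) (v : V),
    VertexOperator.ncoeff (Y omega) (m + 1) (VertexOperator.ncoeff (Y omega) (n + 1) v)
      - VertexOperator.ncoeff (Y omega) (n + 1) (VertexOperator.ncoeff (Y omega) (m + 1) v)
    = ((m : ℂ) - n) • VertexOperator.ncoeff (Y omega) (m + n + 1) v
      + (if m + n = 0 then ((m : ℂ) ^ 3 - m) / 12 * charge else 0) • v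
  /-- the `L(-1)`-derivative property: `Y(L(-1)a, z) = d/dz Y(a, z)` -/
  derivative : ∀ (a v : V) (n : ℤ),
    VertexOperator.ncoeff (Y (VertexOperator.ncoeff (Y omega) 0 a)) n v
      = (-(n : ℂ)) • VertexOperator.ncoeff (Y a) (n - 1) v
  /-- `V` is the direct sum over `n : ℤ` of the `L(0)`-eigenspaces `V_n` -/
  grading : DirectSum.IsInternal fun n : ℤ =>
    Module.End.eigenspace (VertexOperator.ncoeff (Y omega) 1) (n : ℂ)
  /-- the weight spaces are finite dimensional -/
  finite_wt : ∀ n : ℤ, FiniteDimensional ℂ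
    (Module.End.eigenspace (VertexOperator.ncoeff (Y omega) 1) (n : ℂ))
  /-- the weights are bounded below -/
  bounded_wt : ∃ n₀ : ℤ, ∀ n < n₀,
    Module.End.eigenspace (VertexOperator.ncoeff (Y omega) 1) (n : ℂ) = ⊥

namespace VertexOperatorAlgebra

variable {V : Type*} [AddCommGroup V] [Module ℂ V]

/-- The mode `a₍ₙ₎` acting on `V`. -/
def mode (A : VertexOperatorAlgebra V) (a : V) (n : ℤ) : Module.End ℂ V :=
  VertexOperator.ncoeff (A.Y a) n

/-- The operator `L(0) = ω₍₁₎`. -/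
def L0 (A : VertexOperatorAlgebra V) : Module.End ℂ V := A.mode A.omega 1

/-- The space `V_n` of vectors of weight `n`. -/
def wtSpace (A : VertexOperatorAlgebra V) (n : ℤ) : Submodule ℂ V :=
  Module.End.eigenspace A.L0 (n : ℂ)

/-- CFT type: no negative weights, and `V_0` is spanned by the vacuum. -/
def IsCFTType (A : VertexOperatorAlgebra V) : Prop :=
  (∀ n : ℤ, n < 0 → A.wtSpace n = ⊥) ∧ A.wtSpace 0 = Submodule.span ℂ {A.vacuum}

/-- `C₂(V)`, the span of all `a₍₋₂₎ b`. -/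
def C2 (A : VertexOperatorAlgebra V) : Submodule ℂ V :=
  Submodule.span ℂ {v | ∃ a b : V, v = A.mode a (-2) b}

/-- `C₂`-cofiniteness: `V / C₂(V)` is finite dimensional. -/
def IsC2Cofinite (A : VertexOperatorAlgebra V) : Prop :=
  FiniteDimensional ℂ (V ⧸ A.C2)

/-- A linear automorphism of `V` is a VOA automorphism if it preserves all products, the vacuum and
the conformal vector. -/
structure IsAutomorphism (A : VertexOperatorAlgebra V) (g : V ≃ₗ[ℂ] V) : Prop where
  map_mode : ∀ (a b : V) (n : ℤ), g (A.mode a n b) = A.mode (g a) n (g b)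
  map_vacuum : g A.vacuum = A.vacuum
  map_omega : g A.omega = A.omega

end VertexOperatorAlgebra

/-- The eigenspace `V^r = {a | g a = exp(2πi r/|g|) a}` of an automorphism `g` of finite order. -/
def twistSpace {V : Type*} [AddCommGroup V] [Module ℂ V] (g : V ≃ₗ[ℂ] V) (r : ℕ) :
    Submodule ℂ V :=
  Module.End.eigenspace (g : V →ₗ[ℂ] V)
    (Complex.exp (2 * Real.pi * Complex.I * ((r : ℂ) / (orderOf g : ℂ))))

/-- `n` lies in the coset `r/|g| + ℤ`. -/
def InCoset {V : Type*} [AddCommGroup V] [Module ℂ V] (g : V ≃ₗ[ℂ] V) (r : ℕ) (n : ℚ) : Prop :=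
  ∃ k : ℤ, n = k + (r : ℚ) / (orderOf g : ℚ)

/-- A weak `g`-twisted module with underlying space `W`, for `g` an automorphism of finite order.
`Y a = ∑ₙ a₍ₙ₎ z⁻ⁿ⁻¹` has rational exponents, `a₍ₙ₎` being its coefficient at `-n-1`.  Since `V` is
the sum of the `V^r`, the field `mode_eq_zero` forces `a₍ₙ₎ = 0` for all `a` unless
`n ∈ (1/|g|)ℤ`. -/
structure WeakTwistedModule {V : Type*} [AddCommGroup V] [Module ℂ V]
    (A : VertexOperatorAlgebra V) (g : V ≃ₗ[ℂ] V)
    (W : Type*) [AddCommGroup W] [Module ℂ W] where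
  /-- the vertex operator map -/
  Y : V →ₗ[ℂ] HVertexOperator ℚ ℂ W W
  /-- for `a ∈ V^r`, only modes `a₍ₙ₎` with `n ∈ r/|g| + ℤ` occur -/
  mode_eq_zero : ∀ (r : ℕ), ∀ a ∈ twistSpace g r, ∀ n : ℚ, ¬ InCoset g r n →
    HVertexOperator.coeff (Y a) (-n - 1) = 0
  /-- `a₍ₙ₎ w = 0` for large `n` -/
  truncation : ∀ (a : V) (w : W), ∃ n₀ : ℚ, ∀ n : ℚ, n₀ ≤ n →
    HVertexOperator.coeff (Y a) (-n - 1) w = 0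
  /-- the vacuum acts as the identity field -/
  vacuum_mode : ∀ (n : ℚ) (w : W),
    HVertexOperator.coeff (Y A.vacuum) (-n - 1) w = if n = -1 then w else 0
  /-- The `g`-twisted Jacobi identity for `a ∈ V^r`: the coefficient of
  `z₀^(-l-1) z₁^(-m-1) z₂^(-n-1)`, applied to `w`; for `m` outside `r/|g| + ℤ` this coefficient
  vanishes on both sides.  All three sums have only finitely many nonzero terms. -/
  jacobi : ∀ (r : ℕ), ∀ a ∈ twistSpace g r, ∀ (b : V) (w : W) (l : ℤ) (m n : ℚ), InCoset g r m →
    (∑ᶠ i : ℕ, ((-1 : ℂ) ^ i * ((Ring.choose l i : ℤ) : ℂ)) •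
      (HVertexOperator.coeff (Y a) (-((l : ℚ) + m - i) - 1)
          (HVertexOperator.coeff (Y b) (-(n + i) - 1) w)
        - (-1 : ℂ) ^ l •
          HVertexOperator.coeff (Y b) (-((l : ℚ) + n - i) - 1)
            (HVertexOperator.coeff (Y a) (-(m + i) - 1) w)))
    = ∑ᶠ i : ℕ, ((Ring.choose m i : ℚ) : ℂ) •
        HVertexOperator.coeff (Y (A.mode a (l + i) b)) (-(m + n - i) - 1) w

/-- A letter `x(n)`, where `x` is a vector of weight `wt`. -/
structure ModeLetter (V : Type*) where
  /-- the vector -/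
  vec : V
  /-- the weight of the vector -/
  wt : ℤ
  /-- the index of the mode -/
  idx : ℚ

namespace ModeLetter

variable {V : Type*} [AddCommGroup V] [Module ℂ V]

/-- The word `x¹(n₁) ⋯ xᵏ(n_k)` is a monomial of the `g`-twisted enveloping algebra with
homogeneous entries: each `xⁱ` is of the recorded weight and lies in some `V^r` with
`nᵢ ∈ r/|g| + ℤ`. -/
def IsMonomial (A : VertexOperatorAlgebra V) (g : V ≃ₗ[ℂ] V) (X : List (ModeLetter V)) : Prop :=
  ∀ x ∈ X, x.vec ∈ A.wtSpace x.wt ∧ ∃ r : ℕ, x.vec ∈ twistSpace g r ∧ InCoset g r x.idx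

/-- The degree `wt x¹ + ⋯ + wt xᵏ`. -/
def degree (X : List (ModeLetter V)) : ℤ := (X.map fun x => x.wt).sum

/-- The weight `(wt x¹ - n₁ - 1) + ⋯ + (wt xᵏ - n_k - 1)`. -/
def weight (X : List (ModeLetter V)) : ℚ := (X.map fun x => (x.wt : ℚ) - x.idx - 1).sum

/-- Normal monomials `α¹(n₁) ⋯ αˢ(n_s)`, with all `αⁱ ∈ U` and `n₁ < ⋯ < n_s < T`. -/
def IsNormal (A : VertexOperatorAlgebra V) (g : V ≃ₗ[ℂ] V) (U : Submodule ℂ V) (T : ℚ)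
    (X : List (ModeLetter V)) : Prop :=
  IsMonomial A g X ∧ (∀ x ∈ X, x.vec ∈ U) ∧
    X.Pairwise (fun x y => x.idx < y.idx) ∧ ∀ x ∈ X, x.idx < T

end ModeLetter

namespace WeakTwistedModule

variable {V : Type*} [AddCommGroup V] [Module ℂ V] {A : VertexOperatorAlgebra V}
  {g : V ≃ₗ[ℂ] V} {W : Type*} [AddCommGroup W] [Module ℂ W]

/-- The mode `a₍ₙ₎` acting on `W`. -/
def mode (M : WeakTwistedModule A g W) (a : V) (n : ℚ) : Module.End ℂ W :=
  HVertexOperator.coeff (M.Y a) (-n - 1)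

/-- `V · w`, the span of all `a₍ₙ₎ w` (which is the submodule generated by `w`). -/
def orbit (M : WeakTwistedModule A g W) (w : W) : Submodule ℂ W :=
  Submodule.span ℂ {v | ∃ (a : V) (n : ℚ), v = M.mode a n w}

/-- The map `φ_w`: the word `x¹(n₁) ⋯ xᵏ(n_k)` is sent to `x¹₍ₙ₁₎ ⋯ xᵏ₍ₙₖ₎ w`. -/
def image (M : WeakTwistedModule A g W) (w : W) (X : List (ModeLetter V)) : W :=
  X.foldr (fun x v => M.mode x.vec x.idx v) w

/-- `β₍ₘ₎ w = 0` for all `β ∈ U` and all `m ≥ T`. -/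
def VanishesFrom (M : WeakTwistedModule A g W) (U : Submodule ℂ V) (w : W) (T : ℚ) : Prop :=
  ∀ β ∈ U, ∀ m : ℚ, T ≤ m → M.mode β m w = 0

end WeakTwistedModule

/-- A finite-dimensional subspace `U` stable under `L(0)` and `g` with `V = U + C₂(V)`. -/
structure IsGeneratingSpace {V : Type*} [AddCommGroup V] [Module ℂ V]
    (A : VertexOperatorAlgebra V) (g : V ≃ₗ[ℂ] V) (U : Submodule ℂ V) : Prop where
  finite : FiniteDimensional ℂ U
  L0_mem : ∀ u ∈ U, A.L0 u ∈ U
  g_mem : ∀ u ∈ U, g u ∈ U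
  sup_C2 : U ⊔ A.C2 = ⊤

end

/-! Monomials are filtered by degree, and every rewriting rule is an instance of the twisted Jacobi
identity, which preserves weight. Since `a₍ᵢ₎ b` has weight `wt a + wt b - i - 1`, three choices of
`l` matter. With `l = 0`, commutators have smaller degree, so letters may be permuted modulo lower
degree (`commutator_mem_filtration`, `image_sub_image_mem`). With `l = -2`, a mode of `a₍₋₂₎ b`, of
weight `wt a + wt b + 1`, is a combination of terms of degree at most `wt a + wt b`. So letters in
`C₂(V)` lower the degree, and all letters may be taken from `U`
(`mode_homogeneousC2_mem_filtration`). With `l = -1`, a product of two modes of equal index becomes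
products with indices `n - e`, `n + e`, `e ≥ 1`, plus a mode of `a₍₋₁₎ b` (same degree, one letter
fewer), plus terms of smaller degree (`mode_mode_same_mem`). The reduction is a triple induction: on
degree, then on length, then on `concentration`, which drops whenever two equal indices are spread
apart. It terminates because negative concentration forces an index `≥ T`; that letter can be moved
next to `w`, which it kills. Distinct indices below `T` only need sorting. The degree induction
starts below zero, where every word maps to zero because there are no negative weights. -/

noncomputable section

/-! ### Linear algebra: eigenspace decompositions and comparison of finite sums -/

/-- A submodule stable under `f` and covered by eigenspaces of `f` is covered by its intersections
with them. -/
lemma Module.End.le_iSup_inf_eigenspace {K E ι : Type*} [Field K] [AddCommGroup E] [Module K E]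
    (f : Module.End K E) {μ : ι → K} (hμ : Function.Injective μ) {p : Submodule K E}
    (hp : ∀ x ∈ p, f x ∈ p) (h : p ≤ ⨆ i, f.eigenspace (μ i)) :
    p ≤ ⨆ i, p ⊓ f.eigenspace (μ i) := by
  classical
  have key : ∀ (s : Finset ι) (v : ι → E), (∀ i, f (v i) = μ i • v i) →
      ∑ i ∈ s, v i ∈ p → ∀ i ∈ s, v i ∈ p := by
    intro s
    induction s using Finset.induction_on with
    | empty => simp
    | insert j s hj ih =>
      intro v hv hsum
      -- Applying `f - μ j` removes the summand `v j` and rescales the others by nonzero scalars.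
      have h1 : ∑ i ∈ s, (μ i - μ j) • v i ∈ p := by
        have h2 := p.sub_mem (hp _ hsum) (p.smul_mem (μ j) hsum)
        rw [map_sum, Finset.smul_sum, ← Finset.sum_sub_distrib, Finset.sum_insert hj] at h2
        simpa [hv, sub_smul] using h2
      have h3 : ∀ i ∈ s, v i ∈ p := by
        intro i hi
        have hne : μ i - μ j ≠ 0 := sub_ne_zero.2 fun e => hj (hμ e ▸ hi)
        exact (p.smul_mem_iff hne).1
          (ih (fun i => (μ i - μ j) • v i) (fun i => by rw [map_smul, hv, smul_comm]) h1 i hi)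
      intro i hi
      rcases Finset.mem_insert.1 hi with rfl | hi
      · rw [Finset.sum_insert hj] at hsum
        exact (p.add_mem_iff_left (p.sum_mem h3)).1 hsum
      · exact h3 i hi
  intro x hx
  obtain ⟨m, hm, rfl⟩ := (Submodule.mem_iSup_iff_exists_finsupp _ _).1 (h hx)
  refine (Submodule.mem_iSup_iff_exists_finsupp _ _).2 ⟨m, fun i => ⟨?_, hm i⟩, rfl⟩
  by_cases hi : i ∈ m.support
  · exact key m.support m (fun i => Module.End.mem_eigenspace_iff.1 (hm i)) hx i hi
  · simp [Finsupp.notMem_support_iff.1 hi]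

/-- If independent elements are covered by smaller ones, they agree with them. -/
lemma iSupIndep.le_of_le_iSup {L ι : Type*} [CompleteLattice L] [IsModularLattice L]
    {E B : ι → L} (hE : iSupIndep E) (hB : B ≤ E) {i : ι} (h : E i ≤ ⨆ j, B j) : E i ≤ B i := by
  have h1 : E i ≤ B i ⊔ ⨆ (j) (_ : j ≠ i), E j := by
    refine h.trans (iSup_le fun j => ?_)
    by_cases hj : j = i
    · subst hj; exact le_sup_left
    · exact ((hB j).trans (le_iSup₂_of_le j hj le_rfl)).trans le_sup_right
  calc E i ≤ (B i ⊔ ⨆ (j) (_ : j ≠ i), E j) ⊓ E i := le_inf h1 le_rfl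
    _ = B i ⊔ (⨆ (j) (_ : j ≠ i), E j) ⊓ E i := sup_inf_assoc_of_le _ (hB i)
    _ ≤ B i := by rw [inf_comm, (hE i).eq_bot, sup_bot_eq]

/-- Comparing two sums termwise modulo a subspace, except for their initial terms. -/
lemma Submodule.sub_mem_of_finsum_eq {K E : Type*} [Ring K] [AddCommGroup E] [Module K E]
    (S : Submodule K E) {f h : ℕ → E} (hf : f.support.Finite) (hh : h.support.Finite)
    (e : ∑ᶠ i, f i = ∑ᶠ i, h i) (hfS : ∀ i, f (i + 1) ∈ S) (hhS : ∀ i, h (i + 1) ∈ S) :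
    f 0 - h 0 ∈ S := by
  obtain ⟨N, hN⟩ := (hf.union hh).bddAbove
  have hsub : ∀ u : ℕ → E, u.support ⊆ f.support ∪ h.support →
      ∑ᶠ i, u i = ∑ i ∈ Finset.range N, u (i + 1) + u 0 := by
    intro u hu
    rw [← Finset.sum_range_succ']
    refine finsum_eq_sum_of_support_subset _ fun i hi => ?_
    have := hN (hu hi)
    simp only [Finset.coe_range, Set.mem_Iio]
    omega
  rw [hsub f Set.subset_union_left, hsub h Set.subset_union_right] at e
  have : f 0 - h 0 = ∑ i ∈ Finset.range N, h (i + 1) - ∑ i ∈ Finset.range N, f (i + 1) := by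
    rw [sub_eq_sub_iff_add_eq_add, add_comm (f 0), e]
  rw [this]
  exact S.sub_mem (S.sum_mem fun i _ => hhS i) (S.sum_mem fun i _ => hfS i)

/-! ### Eigenspaces of an automorphism of finite order -/

section TwistSpace

variable {V : Type*} [AddCommGroup V] [Module ℂ V] {g : V ≃ₗ[ℂ] V}

/-- The standard root of unity of order `|g|`. -/
def twistRoot (g : V ≃ₗ[ℂ] V) : ℂ := Complex.exp (2 * Real.pi * Complex.I / (orderOf g : ℂ))

lemma isPrimitiveRoot_twistRoot (hfin : IsOfFinOrder g) :
    IsPrimitiveRoot (twistRoot g) (orderOf g) :=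
  Complex.isPrimitiveRoot_exp _ hfin.orderOf_pos.ne'

lemma mem_twistSpace {r : ℕ} {x : V} : x ∈ twistSpace g r ↔ g x = twistRoot g ^ r • x := by
  rw [twistSpace, Module.End.mem_eigenspace_iff, twistRoot, ← Complex.exp_nat_mul]
  have : (2 * Real.pi * Complex.I * ((r : ℂ) / (orderOf g : ℂ))) =
    (r : ℂ) * (2 * Real.pi * Complex.I / (orderOf g : ℂ)) := by ring
  rw [this]; rfl

lemma twistRoot_pow_eq (hfin : IsOfFinOrder g) {r s : ℕ} (h : r ≡ s [MOD orderOf g]) :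
    twistRoot g ^ r = twistRoot g ^ s := by
  have h1 := (isPrimitiveRoot_twistRoot hfin).pow_eq_one
  rw [pow_eq_pow_mod r h1, pow_eq_pow_mod s h1, show r % orderOf g = s % orderOf g from h]

lemma twistSpace_congr (hfin : IsOfFinOrder g) {r s : ℕ} (h : r ≡ s [MOD orderOf g]) :
    twistSpace g r = twistSpace g s := by
  ext x; rw [mem_twistSpace, mem_twistSpace, twistRoot_pow_eq hfin h]

lemma InCoset.congr (hfin : IsOfFinOrder g) {r s : ℕ} (h : r ≡ s [MOD orderOf g]) {n : ℚ}
    (hn : InCoset g r n) : InCoset g s n := by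
  obtain ⟨k, rfl⟩ := hn
  obtain ⟨c, hc⟩ := (Nat.modEq_iff_dvd.1 h)
  have hD : (orderOf g : ℚ) ≠ 0 := by exact_mod_cast hfin.orderOf_pos.ne'
  refine ⟨k - c, ?_⟩
  have : (s : ℚ) = r + orderOf g * c := by
    have : (s : ℤ) = r + orderOf g * c := by linarith
    exact_mod_cast this
  rw [this]
  push_cast
  field_simp
  ring

lemma InCoset.add {r s : ℕ} {m n : ℚ} (hm : InCoset g r m) (hn : InCoset g s n) :
    InCoset g (r + s) (m + n) := by
  obtain ⟨k, rfl⟩ := hm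
  obtain ⟨l, rfl⟩ := hn
  exact ⟨k + l, by push_cast; ring⟩

lemma InCoset.add_int {r : ℕ} {n : ℚ} (hn : InCoset g r n) (j : ℤ) : InCoset g r (n + j) := by
  obtain ⟨k, rfl⟩ := hn
  exact ⟨k + j, by push_cast; ring⟩

lemma InCoset.of_add {r s : ℕ} {m n : ℚ} (hm : InCoset g r m) (h : InCoset g (r + s) (m + n)) :
    InCoset g s n := by
  obtain ⟨k, rfl⟩ := hm
  obtain ⟨l, hl⟩ := h
  refine ⟨l - k, ?_⟩
  push_cast at hl ⊢
  rw [add_div] at hl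
  linarith

/-- A `g`-stable subspace is covered by its intersections with the eigenspaces of `g`. -/
lemma le_iSup_inf_twistSpace (hfin : IsOfFinOrder g) {S : Submodule ℂ V}
    (hS : ∀ x ∈ S, g x ∈ S) : S ≤ ⨆ r : Fin (orderOf g), S ⊓ twistSpace g r := by
  intro v hv
  set D := orderOf g with hDdef
  have hD : 0 < D := hfin.orderOf_pos
  have hζ := isPrimitiveRoot_twistRoot hfin
  set ζ := twistRoot g
  have hζ0 : ζ ≠ 0 := hζ.ne_zero hD.ne'
  -- `P r` is `D` times the projection of `v` to the `ζ ^ r`-eigenspace; orthogonality of characters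
  -- gives `∑ P r = D • v`.
  let P : ℕ → V := fun r => ∑ j ∈ Finset.range D, (ζ⁻¹ ^ r) ^ j • (g ^ j) v
  have hgS : ∀ j : ℕ, (g ^ j) v ∈ S := by
    intro j
    induction j with
    | zero => simpa using hv
    | succ j ih => rw [pow_succ']; exact hS _ ih
  have hPS : ∀ r, P r ∈ S := fun r => S.sum_mem fun j _ => S.smul_mem _ (hgS j)
  have hPE : ∀ r, P r ∈ twistSpace g r := by
    intro r
    rw [mem_twistSpace]
    have hc : ∀ j, g ((g ^ j) v) = (g ^ (j + 1)) v := fun j => by rw [pow_succ']; rfl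
    have hz : (ζ⁻¹ ^ r) ^ D = 1 := by
      rw [← pow_mul, mul_comm, pow_mul, inv_pow, hζ.pow_eq_one]; simp
    have h1 : ζ⁻¹ ^ r • g (P r) = P r := by
      have : ζ⁻¹ ^ r • g (P r) =
          ∑ j ∈ Finset.range D, (ζ⁻¹ ^ r) ^ (j + 1) • (g ^ (j + 1)) v := by
        simp only [P, map_sum, map_smul, hc, Finset.smul_sum, smul_smul, pow_succ' (ζ⁻¹ ^ r)]
      rw [this]
      have h2 := Finset.sum_range_succ (fun j => (ζ⁻¹ ^ r) ^ j • (g ^ j) v) D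
      rw [Finset.sum_range_succ', hz, hDdef, pow_orderOf_eq_one] at h2
      simpa [P] using h2
    calc g (P r) = ζ ^ r • ζ⁻¹ ^ r • g (P r) := by
          rw [smul_smul, ← mul_pow, mul_inv_cancel₀ hζ0, one_pow, one_smul]
      _ = _ := by rw [h1]
  have hsum : ∑ r ∈ Finset.range D, P r = (D : ℂ) • v := by
    simp only [P]
    rw [Finset.sum_comm, Finset.sum_eq_single_of_mem 0 (Finset.mem_range.2 hD)]
    · simp [← Nat.cast_smul_eq_nsmul ℂ]
    · intro j hj hj0
      rw [← Finset.sum_smul]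
      have hne : ζ⁻¹ ^ j ≠ 1 :=
        hζ.inv.pow_ne_one_of_pos_of_lt hj0 (Finset.mem_range.1 hj)
      have h3 := mul_geom_sum (ζ⁻¹ ^ j) D
      rw [← pow_mul, mul_comm j, pow_mul, hζ.inv.pow_eq_one, one_pow, sub_self] at h3
      have h4 := (mul_eq_zero.1 h3).resolve_left (sub_ne_zero.2 hne)
      have : ∑ i ∈ Finset.range D, (ζ⁻¹ ^ i) ^ j = 0 := by
        rw [← h4]; exact Finset.sum_congr rfl fun i _ => pow_right_comm _ _ _
      rw [this, zero_smul]
  have hv' : v = (D : ℂ)⁻¹ • ∑ r ∈ Finset.range D, P r := by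
    rw [hsum, smul_smul, inv_mul_cancel₀ (by exact_mod_cast hD.ne'), one_smul]
  rw [hv']
  refine Submodule.smul_mem _ _ (Submodule.sum_mem _ fun r hr => ?_)
  exact Submodule.mem_iSup_of_mem ⟨r, Finset.mem_range.1 hr⟩ ⟨hPS r, hPE r⟩

end TwistSpace

/-! ### The gradings of `V` by weight and by `g`, and their compatibility with `C₂(V)` -/

namespace VertexOperatorAlgebra

variable {V : Type*} [AddCommGroup V] [Module ℂ V] (A : VertexOperatorAlgebra V)
  {g : V ≃ₗ[ℂ] V}

lemma mode_add (a b : V) (n : ℤ) : A.mode (a + b) n = A.mode a n + A.mode b n := by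
  simp [mode]

lemma mode_smul (c : ℂ) (a : V) (n : ℤ) : A.mode (c • a) n = c • A.mode a n := by
  simp [mode]

/-- The mode `a₍ₙ₎ b` as a bilinear map. -/
def modeHom (n : ℤ) : V →ₗ[ℂ] V →ₗ[ℂ] V where
  toFun a := A.mode a n
  map_add' a b := A.mode_add a b n
  map_smul' c a := A.mode_smul c a n

lemma L0_mode (a b : V) (n : ℤ) :
    A.L0 (A.mode a n b) =
      A.mode a n (A.L0 b) + A.mode (A.L0 a) n b - ((n : ℂ) + 1) • A.mode a n b := by
  -- Only `i = 0` survives on the left and `i = 0, 1` on the right: this is the commutator of `L(0)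
  -- = ω₍₁₎` with `a₍ₙ₎`, whose term `(ω₍₀₎ a)₍ₙ₊₁₎` is evaluated by the derivative property.
  have h := A.jacobi A.omega a b 0 1 n
  rw [finsum_eq_sum_of_support_subset (s := Finset.range 1),
    finsum_eq_sum_of_support_subset (s := Finset.range 2)] at h
  · have hd := A.derivative a b (1 + n)
    simp only [Finset.sum_range_succ, Finset.sum_range_zero] at h
    have e1 : Ring.choose (1 : ℤ) 1 = 1 := by simp
    simp only [Nat.cast_zero, Nat.cast_one, Ring.choose_zero_right, e1, zero_add, sub_zero,
      pow_zero, zpow_zero, Int.cast_one, one_smul, mul_one, add_zero, add_sub_cancel_left, hd] at h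
    simp only [L0, mode]
    rw [sub_eq_iff_eq_add] at h
    rw [h]
    push_cast
    module
  · intro i hi
    by_contra hi'
    simp only [Finset.coe_range, Set.mem_Iio, not_lt] at hi'
    refine hi ?_
    have : Ring.choose (1 : ℤ) i = 0 := by
      have := Ring.choose_natCast (R := ℤ) 1 i
      rw [Nat.choose_eq_zero_of_lt (by omega)] at this
      simpa using this
    simp [this]
  · intro i hi
    by_contra hi'
    simp only [Finset.coe_range, Set.mem_Iio, not_lt] at hi'
    refine hi ?_
    have : Ring.choose (0 : ℤ) i = 0 := Ring.choose_zero_pos ℤ (by omega)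
    simp [this]

lemma mem_wtSpace {p : ℤ} {a : V} : a ∈ A.wtSpace p ↔ A.L0 a = (p : ℂ) • a :=
  Module.End.mem_eigenspace_iff

lemma mode_mem_wtSpace {p q : ℤ} {a b : V} (ha : a ∈ A.wtSpace p) (hb : b ∈ A.wtSpace q)
    (n : ℤ) {k : ℤ} (hk : k = p + q - n - 1) : A.mode a n b ∈ A.wtSpace k := by
  rw [mem_wtSpace] at *
  rw [L0_mode, ha, hb, mode_smul, hk, map_smul, LinearMap.smul_apply]
  push_cast
  module

lemma mode_mem_twistSpace (hg : A.IsAutomorphism g) {r s : ℕ} {a b : V}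
    (ha : a ∈ twistSpace g r) (hb : b ∈ twistSpace g s) (n : ℤ) :
    A.mode a n b ∈ twistSpace g (r + s) := by
  rw [mem_twistSpace] at *
  rw [hg.map_mode, ha, hb, mode_smul, map_smul, LinearMap.smul_apply, smul_smul, pow_add, mul_comm]

lemma eq_zero_of_wt_neg (hCFT : A.IsCFTType) {p : ℤ} (hp : p < 0) {a : V}
    (ha : a ∈ A.wtSpace p) : a = 0 := by
  rw [hCFT.1 p hp] at ha; exact ha

lemma L0_apply_comm (hg : A.IsAutomorphism g) (x : V) : g (A.L0 x) = A.L0 (g x) := by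
  rw [L0, hg.map_mode, hg.map_omega]

/-- Vectors of weight `p` in `V^r`. -/
def homogeneous (g : V ≃ₗ[ℂ] V) (p : ℤ) (r : ℕ) : Submodule ℂ V := A.wtSpace p ⊓ twistSpace g r

lemma iSup_wtSpace : ⨆ p : ℤ, A.wtSpace p = ⊤ := A.grading.submodule_iSup_eq_top

lemma le_iSup_inf_wtSpace {S : Submodule ℂ V} (hS : ∀ x ∈ S, A.L0 x ∈ S) :
    S ≤ ⨆ p : ℤ, S ⊓ A.wtSpace p :=
  Module.End.le_iSup_inf_eigenspace A.L0 (μ := fun p : ℤ => (p : ℂ)) Int.cast_injective hS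
    (le_top.trans A.iSup_wtSpace.ge)

lemma le_iSup_inf_homogeneous (hfin : IsOfFinOrder g) (hg : A.IsAutomorphism g)
    {S : Submodule ℂ V} (hS : ∀ x ∈ S, A.L0 x ∈ S) (hgS : ∀ x ∈ S, g x ∈ S) :
    S ≤ ⨆ (p : ℤ) (r : Fin (orderOf g)), S ⊓ A.homogeneous g p r := by
  refine (A.le_iSup_inf_wtSpace hS).trans (iSup_mono fun p => ?_)
  refine (le_iSup_inf_twistSpace hfin ?_).trans (iSup_mono fun r => ?_)
  · rintro x ⟨hx, hxp⟩
    refine ⟨hgS x hx, ?_⟩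
    have hxp : A.L0 x = (p : ℂ) • x := A.mem_wtSpace.1 hxp
    exact A.mem_wtSpace.2 (by rw [← A.L0_apply_comm hg, hxp, map_smul])
  · exact (inf_assoc _ _ _).le

/-- The set of vectors that are homogeneous for both gradings. -/
def homogeneousSet (g : V ≃ₗ[ℂ] V) : Set V := {v | ∃ p r, v ∈ A.homogeneous g p r}

lemma span_homogeneousSet (hfin : IsOfFinOrder g) (hg : A.IsAutomorphism g) :
    Submodule.span ℂ (A.homogeneousSet g) = ⊤ := by
  refine top_le_iff.1 ((A.le_iSup_inf_homogeneous hfin hg (S := ⊤) (by simp) (by simp)).trans ?_)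
  exact iSup_le fun p => iSup_le fun r => fun v hv => Submodule.subset_span ⟨p, r, hv.2⟩

/-- The span of the `a₍₋₂₎ b` of weight `p` in `V^r`, with `a` and `b` homogeneous. -/
def homogeneousC2 (g : V ≃ₗ[ℂ] V) (p : ℤ) (r : ℕ) : Submodule ℂ V :=
  Submodule.span ℂ {v | ∃ (q₁ q₂ : ℤ) (s₁ s₂ : ℕ) (a b : V), a ∈ A.homogeneous g q₁ s₁ ∧
    b ∈ A.homogeneous g q₂ s₂ ∧ p = q₁ + q₂ + 1 ∧ s₁ + s₂ ≡ r [MOD orderOf g] ∧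
    v = A.mode a (-2) b}

lemma C2_le (hfin : IsOfFinOrder g) (hg : A.IsAutomorphism g) :
    A.C2 ≤ ⨆ (p : ℤ) (r : Fin (orderOf g)), A.homogeneousC2 g p r := by
  have h1 : A.C2 ≤ Submodule.map₂ (A.modeHom (-2)) ⊤ ⊤ := by
    refine Submodule.span_le.2 ?_
    rintro _ ⟨a, b, rfl⟩
    exact Submodule.apply_mem_map₂ _ (Submodule.mem_top (x := a)) (Submodule.mem_top (x := b))
  refine h1.trans ?_
  rw [← A.span_homogeneousSet hfin hg, Submodule.map₂_span_span]
  refine Submodule.span_le.2 ?_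
  rintro _ ⟨a, ⟨p, r, ha⟩, b, ⟨q, s, hb⟩, rfl⟩
  refine Submodule.mem_iSup_of_mem (p + q + 1) (Submodule.mem_iSup_of_mem
    ⟨(r + s) % orderOf g, Nat.mod_lt _ hfin.orderOf_pos⟩ (Submodule.subset_span ?_))
  exact ⟨p, q, r, s, a, b, ha, hb, rfl, (Nat.mod_modEq _ _).symm, rfl⟩

lemma homogeneousC2_le (hfin : IsOfFinOrder g) (hg : A.IsAutomorphism g) (p : ℤ) (r : ℕ) :
    A.homogeneousC2 g p r ≤ A.homogeneous g p r := by
  refine Submodule.span_le.2 ?_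
  rintro _ ⟨q₁, q₂, s₁, s₂, a, b, ha, hb, rfl, hs, rfl⟩
  refine ⟨A.mode_mem_wtSpace ha.1 hb.1 _ (by ring), ?_⟩
  have h := A.mode_mem_twistSpace hg ha.2 hb.2 (-2)
  rwa [twistSpace_congr hfin hs] at h

/-- If `V = U + C₂(V)` with `U` stable, then this decomposition is compatible with the gradings. -/
lemma homogeneous_le_sup (hfin : IsOfFinOrder g) (hg : A.IsAutomorphism g) {U : Submodule ℂ V}
    (hU : IsGeneratingSpace A g U) (p : ℤ) (r : ℕ) :
    A.homogeneous g p r ≤ (U ⊓ A.homogeneous g p r) ⊔ A.homogeneousC2 g p r := by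
  let B : ℤ → Fin (orderOf g) → Submodule ℂ V := fun p r =>
    (U ⊓ A.homogeneous g p r) ⊔ A.homogeneousC2 g p r
  have hB : ∀ p r, B p r ≤ A.homogeneous g p r := fun p r =>
    sup_le inf_le_right (A.homogeneousC2_le hfin hg p r)
  have htop : ⊤ ≤ ⨆ p, ⨆ r, B p r := by
    rw [← hU.sup_C2]
    refine sup_le ?_ ?_
    · exact (A.le_iSup_inf_homogeneous hfin hg hU.L0_mem hU.g_mem).trans
        (iSup_mono fun p => iSup_mono fun r => le_sup_left)
    · exact (A.C2_le hfin hg).trans (iSup_mono fun p => iSup_mono fun r => le_sup_right)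
  -- The bihomogeneous pieces `B` exhaust `V`; independence of the eigenspaces of `L(0)`, and then
  -- of those of `g`, forces equality piece by piece.
  have h1 : A.wtSpace p ≤ ⨆ r, B p r :=
    iSupIndep.le_of_le_iSup (E := A.wtSpace) (B := fun p => ⨆ r, B p r)
      (A.L0.eigenspaces_iSupIndep.comp (f := fun n : ℤ => (n : ℂ)) Int.cast_injective)
      (fun p => iSup_le fun r => (hB p r).trans inf_le_left) (le_top.trans htop)
  have key : ∀ r : Fin (orderOf g), A.homogeneous g p r ≤ B p r := by
    intro r
    have hinj : Function.Injective fun r : Fin (orderOf g) =>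
        Complex.exp (2 * Real.pi * Complex.I * (((r : ℕ) : ℂ) / (orderOf g : ℂ))) := by
      intro i j hij
      have e : ∀ k : ℕ, Complex.exp (2 * Real.pi * Complex.I * ((k : ℂ) / (orderOf g : ℂ))) =
          twistRoot g ^ k := by
        intro k
        rw [twistRoot, ← Complex.exp_nat_mul]; congr 1; ring
      simp only [e] at hij
      exact Fin.ext ((isPrimitiveRoot_twistRoot hfin).pow_inj i.2 j.2 hij)
    have hind : iSupIndep fun r : Fin (orderOf g) => A.homogeneous g p r :=
      ((Module.End.eigenspaces_iSupIndep (g : V →ₗ[ℂ] V)).comp hinj).mono fun r => inf_le_right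
    exact hind.le_of_le_iSup (hB p) (inf_le_left.trans h1)
  have hr : r % orderOf g ≡ r [MOD orderOf g] := Nat.mod_modEq _ _
  have h2 := key ⟨r % orderOf g, Nat.mod_lt _ hfin.orderOf_pos⟩
  have e1 : A.homogeneous g p (r % orderOf g) = A.homogeneous g p r := by
    rw [homogeneous, homogeneous, twistSpace_congr hfin hr]
  have e2 : A.homogeneousC2 g p (r % orderOf g) = A.homogeneousC2 g p r := by
    simp only [homogeneousC2, Nat.ModEq, Nat.mod_mod]
  simpa only [B, e1, e2] using h2

/-- Classes of bihomogeneous vectors span `V / C₂(V)`, so finitely many of them do. Their lifts are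
common eigenvectors of `L(0)` and `g`, hence have a stable span. -/
lemma exists_isGeneratingSpace (hC2 : A.IsC2Cofinite) (hg : A.IsAutomorphism g)
    (hfin : IsOfFinOrder g) : ∃ U : Submodule ℂ V, IsGeneratingSpace A g U := by
  classical
  have hfd : FiniteDimensional ℂ (V ⧸ A.C2) := hC2
  have htop : Submodule.span ℂ (A.C2.mkQ '' A.homogeneousSet g) = ⊤ := by
    rw [← Submodule.map_span, A.span_homogeneousSet hfin hg, Submodule.map_top,
      Submodule.range_mkQ]
  obtain ⟨s, hs, hspan⟩ := (Submodule.fg_span_iff_fg_span_finset_subset _).1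
    (htop ▸ Module.Finite.fg_top : (Submodule.span ℂ (A.C2.mkQ '' A.homogeneousSet g)).FG)
  obtain ⟨t, ht, hts⟩ := Finset.subset_set_image_iff.1 hs
  have hst : ∀ f : V →ₗ[ℂ] V, (∀ x ∈ A.homogeneousSet g, ∃ c : ℂ, f x = c • x) →
      ∀ u ∈ Submodule.span ℂ (t : Set V), f u ∈ Submodule.span ℂ (t : Set V) := by
    intro f hf u hu
    refine (Submodule.span_le (p := (Submodule.span ℂ (t : Set V)).comap f)).2 ?_ hu
    intro x hx
    obtain ⟨c, hc⟩ := hf x (ht hx)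
    simpa [hc] using Submodule.smul_mem _ c (Submodule.subset_span hx)
  refine ⟨Submodule.span ℂ (t : Set V), FiniteDimensional.span_finset ℂ t, ?_, ?_, ?_⟩
  · exact hst A.L0 fun x ⟨p, r, hx⟩ => ⟨_, A.mem_wtSpace.1 hx.1⟩
  · exact hst g fun x ⟨p, r, hx⟩ => ⟨_, mem_twistSpace.1 hx.2⟩
  · rw [eq_top_iff]
    intro v _
    have hv : A.C2.mkQ v ∈ Submodule.map A.C2.mkQ (Submodule.span ℂ (t : Set V)) := by
      have : Submodule.span ℂ (s : Set (V ⧸ A.C2)) = ⊤ := by rw [← hspan, htop]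
      rw [Submodule.map_span, ← Finset.coe_image, hts, this]
      trivial
    obtain ⟨u, hu, huv⟩ := hv
    have h2 : v - u ∈ A.C2 := (Submodule.Quotient.eq _).1 huv.symm
    exact Submodule.mem_sup.2 ⟨u, hu, v - u, h2, by abel⟩

end VertexOperatorAlgebra

/-! ### Degree and weight of words -/

namespace ModeLetter

variable {V : Type*}

@[simp] lemma degree_nil : degree ([] : List (ModeLetter V)) = 0 := rfl

@[simp] lemma degree_cons (x : ModeLetter V) (X : List (ModeLetter V)) :
    degree (x :: X) = x.wt + degree X := by simp [degree]

@[simp] lemma degree_append (X Y : List (ModeLetter V)) :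
    degree (X ++ Y) = degree X + degree Y := by simp [degree]

@[simp] lemma weight_nil : weight ([] : List (ModeLetter V)) = 0 := rfl

@[simp] lemma weight_cons (x : ModeLetter V) (X : List (ModeLetter V)) :
    weight (x :: X) = ((x.wt : ℚ) - x.idx - 1) + weight X := by simp [weight]

@[simp] lemma weight_append (X Y : List (ModeLetter V)) :
    weight (X ++ Y) = weight X + weight Y := by simp [weight]

lemma degree_perm {X Y : List (ModeLetter V)} (h : X.Perm Y) : degree X = degree Y :=
  (h.map _).sum_eq

lemma weight_perm {X Y : List (ModeLetter V)} (h : X.Perm Y) : weight X = weight Y :=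
  (h.map _).sum_eq

variable [AddCommGroup V] [Module ℂ V] {A : VertexOperatorAlgebra V} {g : V ≃ₗ[ℂ] V}

lemma isMonomial_cons {x : ModeLetter V} {X : List (ModeLetter V)} :
    IsMonomial A g (x :: X) ↔
      (x.vec ∈ A.wtSpace x.wt ∧ ∃ r : ℕ, x.vec ∈ twistSpace g r ∧ InCoset g r x.idx) ∧
        IsMonomial A g X := by
  simp [IsMonomial]

lemma isMonomial_append {X Y : List (ModeLetter V)} :
    IsMonomial A g (X ++ Y) ↔ IsMonomial A g X ∧ IsMonomial A g Y := by
  simp only [IsMonomial, List.mem_append]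
  exact ⟨fun h => ⟨fun x hx => h x (.inl hx), fun x hx => h x (.inr hx)⟩,
    fun h x hx => hx.elim (h.1 x) (h.2 x)⟩

lemma IsMonomial.perm {X Y : List (ModeLetter V)} (hX : IsMonomial A g X) (h : X.Perm Y) :
    IsMonomial A g Y := fun x hx => hX x (h.mem_iff.2 hx)

end ModeLetter

/-! ### Consequences of the Jacobi identity for the degree filtration -/

namespace WeakTwistedModule

open ModeLetter

variable {V : Type*} [AddCommGroup V] [Module ℂ V] {A : VertexOperatorAlgebra V}
  {g : V ≃ₗ[ℂ] V} {W : Type*} [AddCommGroup W] [Module ℂ W]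
  (M : WeakTwistedModule A g W)

lemma mode_add (a b : V) (n : ℚ) : M.mode (a + b) n = M.mode a n + M.mode b n := by
  simp [mode]

lemma mode_smul (c : ℂ) (a : V) (n : ℚ) : M.mode (c • a) n = c • M.mode a n := by
  simp [mode]

lemma mode_zero (n : ℚ) : M.mode 0 n = 0 := by simp [mode]

/-- The modes `a₍ₙ₎ v` as a linear function of `a`. -/
def modeHom (n : ℚ) (v : W) : V →ₗ[ℂ] W where
  toFun a := M.mode a n v
  map_add' a b := by rw [M.mode_add]; rfl
  map_smul' c a := by rw [M.mode_smul]; rfl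

/-- The composite of the modes of a word. -/
def imageHom (X : List (ModeLetter V)) : Module.End ℂ W :=
  (X.map fun x => M.mode x.vec x.idx).prod

lemma image_eq (w : W) (X : List (ModeLetter V)) : M.image w X = M.imageHom X w := by
  induction X with
  | nil => rfl
  | cons x X ih =>
    simp only [imageHom, image, List.map_cons, List.prod_cons, List.foldr_cons] at ih ⊢
    rw [ih]; rfl

@[simp] lemma image_cons (w : W) (x : ModeLetter V) (X : List (ModeLetter V)) :
    M.image w (x :: X) = M.mode x.vec x.idx (M.image w X) := rfl

lemma image_append (w : W) (X Y : List (ModeLetter V)) :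
    M.image w (X ++ Y) = M.image (M.image w Y) X := by
  simp [image]

lemma finite_setOf_mode_ne_zero (b : V) (v : W) (n : ℚ) :
    {i : ℕ | M.mode b (n + i) v ≠ 0}.Finite := by
  obtain ⟨n₀, h⟩ := M.truncation b v
  refine (Set.finite_lt_nat ⌈n₀ - n⌉₊).subset fun i hi => ?_
  by_contra hlt
  refine hi (h _ ?_)
  have h1 : (⌈n₀ - n⌉₊ : ℚ) ≤ i := by exact_mod_cast not_lt.1 hlt
  linarith [Nat.le_ceil (n₀ - n)]

/-- The Jacobi identity modulo a subspace containing all but the leading terms. -/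
lemma jacobi_sub_mem (hCFT : A.IsCFTType) (S : Submodule ℂ W) {p q : ℤ} {r : ℕ} {a b : V}
    (ha : a ∈ A.wtSpace p) (har : a ∈ twistSpace g r) (hb : b ∈ A.wtSpace q) (v : W)
    (l : ℤ) {m n : ℚ} (hm : InCoset g r m)
    (h₁ : l ≠ 0 → ∀ i : ℕ, M.mode a (l + m - (i + 1)) (M.mode b (n + (i + 1)) v) ∈ S)
    (h₂ : l ≠ 0 → ∀ i : ℕ, M.mode b (l + n - (i + 1)) (M.mode a (m + (i + 1)) v) ∈ S)
    (h₃ : ∀ i : ℕ, M.mode (A.mode a (l + (i + 1)) b) (m + n - (i + 1)) v ∈ S) :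
    M.mode a (l + m) (M.mode b n v) - (-1 : ℂ) ^ l • M.mode b (l + n) (M.mode a m v)
      - M.mode (A.mode a l b) (m + n) v ∈ S := by
  -- Finite support must be checked, as `finsum` is zero otherwise: on the left it comes from
  -- truncation, on the right from the absence of negative weights.
  have h := S.sub_mem_of_finsum_eq (K := ℂ) ?_ ?_ (M.jacobi r a har b v l m n hm) ?_ ?_
  · simpa [mode] using h
  · refine ((M.finite_setOf_mode_ne_zero b v n).union
      (M.finite_setOf_mode_ne_zero a v m)).subset fun i hi => ?_
    by_contra hn
    simp only [Set.mem_union, Set.mem_ofPred_eq, not_or, not_not, mode] at hn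
    exact hi (by simp only [hn.1, hn.2, map_zero, smul_zero, sub_zero])
  · refine (Set.finite_lt_nat (p + q - l).toNat).subset fun i hi => ?_
    by_contra hn
    have : A.mode a (l + i) b = 0 := by
      refine A.eq_zero_of_wt_neg hCFT ?_ (A.mode_mem_wtSpace ha hb (l + i) rfl)
      simp only [Set.mem_ofPred_eq, not_lt, Int.toNat_le] at hn
      omega
    exact hi (by simp [this])
  · intro i
    by_cases hl : l = 0
    · subst hl
      rw [Ring.choose_zero_pos ℤ (by omega)]
      simp
    · refine S.smul_mem _ (S.sub_mem ?_ (S.smul_mem _ ?_))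
      · have := h₁ hl i; simpa [mode] using this
      · have := h₂ hl i; simpa [mode] using this
  · intro i
    refine S.smul_mem _ ?_
    have := h₃ i
    simpa [mode] using this

/-- The span of the images of the monomials of weight `c` and degree at most `d`. -/
def filtration (w : W) (d : ℤ) (c : ℚ) : Submodule ℂ W :=
  Submodule.span ℂ {v | ∃ X : List (ModeLetter V), IsMonomial A g X ∧ degree X ≤ d ∧
    weight X = c ∧ v = M.image w X}

/-- The span of the images of the normal monomials of weight `c` and degree at most `d`. -/
def normalSpan (U : Submodule ℂ V) (T : ℚ) (w : W) (d : ℤ) (c : ℚ) : Submodule ℂ W :=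
  Submodule.span ℂ {v | ∃ Z : List (ModeLetter V), IsNormal A g U T Z ∧ degree Z ≤ d ∧
    weight Z = c ∧ v = M.image w Z}

variable {M} {w : W}

lemma image_mem_filtration {X : List (ModeLetter V)} (hX : IsMonomial A g X) {d : ℤ}
    (hd : degree X ≤ d) {c : ℚ} (hc : weight X = c) : M.image w X ∈ M.filtration w d c :=
  Submodule.subset_span ⟨X, hX, hd, hc, rfl⟩

lemma image_mem_normalSpan {U : Submodule ℂ V} {T : ℚ} {X : List (ModeLetter V)}
    (hX : IsNormal A g U T X) {d : ℤ} (hd : degree X ≤ d) {c : ℚ} (hc : weight X = c) :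
    M.image w X ∈ M.normalSpan U T w d c :=
  Submodule.subset_span ⟨X, hX, hd, hc, rfl⟩

lemma filtration_mono {d e : ℤ} (h : d ≤ e) (c : ℚ) :
    M.filtration w d c ≤ M.filtration w e c :=
  Submodule.span_mono fun _ ⟨X, hX, hd, hc, hv⟩ => ⟨X, hX, hd.trans h, hc, hv⟩

lemma normalSpan_mono {U : Submodule ℂ V} {T : ℚ} {d e : ℤ} (h : d ≤ e) (c : ℚ) :
    M.normalSpan U T w d c ≤ M.normalSpan U T w e c :=
  Submodule.span_mono fun _ ⟨X, hX, hd, hc, hv⟩ => ⟨X, hX, hd.trans h, hc, hv⟩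

lemma mode_mem_filtration {p : ℤ} {r : ℕ} {a : V} (ha : a ∈ A.wtSpace p)
    (har : a ∈ twistSpace g r) {n : ℚ} (hn : InCoset g r n) {v : W} {d d' : ℤ} {c c' : ℚ}
    (hv : v ∈ M.filtration w d c) (hd : p + d ≤ d') (hc : p - n - 1 + c = c') :
    M.mode a n v ∈ M.filtration w d' c' := by
  refine (Submodule.span_le (p := (M.filtration w d' c').comap (M.mode a n))).2 ?_ hv
  rintro _ ⟨X, hX, hXd, hXc, rfl⟩
  refine image_mem_filtration (X := ⟨a, p, n⟩ :: X)
    (isMonomial_cons.2 ⟨⟨ha, r, har, hn⟩, hX⟩) ?_ ?_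
  · simp; omega
  · simp [hXc, hc]

lemma image_mem_filtration_of_mem {X : List (ModeLetter V)} (hX : IsMonomial A g X) {v : W}
    {d : ℤ} {c : ℚ} (hv : v ∈ M.filtration w d c) :
    M.image v X ∈ M.filtration w (degree X + d) (weight X + c) := by
  induction X with
  | nil => simpa [image] using hv
  | cons x X ih =>
    obtain ⟨⟨hx, r, hxr, hn⟩, hX⟩ := isMonomial_cons.1 hX
    exact mode_mem_filtration hx hxr hn (ih hX) (by simp [add_assoc]) (by simp [add_assoc])

/-- For `l = 0` the commutator is a combination of modes of `a₍ᵢ₎ b` with `i ≥ 0`, of weight at most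
`p + q - 1`. -/
lemma commutator_mem_filtration (hCFT : A.IsCFTType) (hg : A.IsAutomorphism g) {p q : ℤ}
    {r s : ℕ} {a b : V} (ha : a ∈ A.wtSpace p) (har : a ∈ twistSpace g r)
    (hb : b ∈ A.wtSpace q) (hbs : b ∈ twistSpace g s) {m n : ℚ} (hm : InCoset g r m)
    (hn : InCoset g s n) {v : W} {d d' : ℤ} {c c' : ℚ} (hv : v ∈ M.filtration w d c)
    (hd : p + q + d - 1 ≤ d') (hc : p - m - 1 + (q - n - 1) + c = c') :
    M.mode a m (M.mode b n v) - M.mode b n (M.mode a m v) ∈ M.filtration w d' c' := by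
  have key : ∀ i : ℕ, M.mode (A.mode a i b) (m + n - i) v ∈ M.filtration w d' c' := by
    intro i
    refine mode_mem_filtration (A.mode_mem_wtSpace ha hb i rfl)
      (A.mode_mem_twistSpace hg har hbs i) ?_ hv (by omega) ?_
    · simpa [sub_eq_add_neg] using (hm.add hn).add_int (-i)
    · rw [← hc]; push_cast; ring
  have h := M.jacobi_sub_mem hCFT (M.filtration w d' c') ha har hb v 0 (n := n) hm
    (by simp) (by simp) (fun i => by simpa using key (i + 1))
  have h0 := key 0
  simp only [Nat.cast_zero, sub_zero] at h0
  simpa using Submodule.add_mem _ h h0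

/-- In the Jacobi identity with `l = -2`, every term other than the leading mode of `a₍₋₂₎ b` has
degree at least one below `p`, the weight of `a₍₋₂₎ b`. -/
lemma mode_homogeneousC2_mem_filtration (hCFT : A.IsCFTType) (hfin : IsOfFinOrder g)
    (hg : A.IsAutomorphism g) {p : ℤ} {r : ℕ} {x : V} (hx : x ∈ A.homogeneousC2 g p r) {n : ℚ}
    (hn : InCoset g r n) {v : W} {d d' : ℤ} {c c' : ℚ} (hv : v ∈ M.filtration w d c)
    (hd : p + d - 1 ≤ d') (hc : p - n - 1 + c = c') :
    M.mode x n v ∈ M.filtration w d' c' := by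
  refine (Submodule.span_le (p := (M.filtration w d' c').comap (M.modeHom n v))).2 ?_ hx
  rintro _ ⟨q₁, q₂, s₁, s₂, a, b, ha, hb, rfl, hs, rfl⟩
  change M.mode (A.mode a (-2) b) n v ∈ M.filtration w d' c'
  -- Any splitting `n = m + k` with `m` in the coset of `a` serves; `k` then lies in the coset of
  -- `b`.
  obtain ⟨m, hm⟩ : ∃ m, InCoset g s₁ m := ⟨_, 0, rfl⟩
  obtain ⟨k, rfl⟩ : ∃ k, n = m + k := ⟨n - m, by ring⟩
  have hk : InCoset g s₂ k := hm.of_add (hn.congr hfin hs.symm)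
  have h₁ : ∀ i : ℕ, M.mode a (((-2 : ℤ) : ℚ) + m - i) (M.mode b (k + i) v) ∈
      M.filtration w d' c' := by
    intro i
    refine mode_mem_filtration ha.1 ha.2 ?_ (mode_mem_filtration hb.1 hb.2 (hk.add_int i) hv
      le_rfl rfl) (by omega) ?_
    · convert hm.add_int (-2 - i) using 1; push_cast; ring
    · rw [← hc]; push_cast; ring
  have h₂ : ∀ i : ℕ, M.mode b (((-2 : ℤ) : ℚ) + k - i) (M.mode a (m + i) v) ∈
      M.filtration w d' c' := by
    intro i
    refine mode_mem_filtration hb.1 hb.2 ?_ (mode_mem_filtration ha.1 ha.2 (hm.add_int i) hv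
      le_rfl rfl) (by omega) ?_
    · convert hk.add_int (-2 - i) using 1; push_cast; ring
    · rw [← hc]; push_cast; ring
  have h₃ : ∀ i : ℕ, M.mode (A.mode a (-2 + (i + 1)) b) (m + k - (i + 1)) v ∈
      M.filtration w d' c' := by
    intro i
    refine mode_mem_filtration (A.mode_mem_wtSpace ha.1 hb.1 _ rfl)
      (A.mode_mem_twistSpace hg ha.2 hb.2 _) ?_ hv (by omega) ?_
    · convert (hm.add hk).add_int (-(i + 1)) using 1; push_cast; ring
    · rw [← hc]; push_cast; ring
  have h := M.jacobi_sub_mem hCFT (M.filtration w d' c') ha.1 ha.2 hb.1 v (-2) (n := k) hm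
    (fun _ i => by exact_mod_cast h₁ (i + 1)) (fun _ i => by exact_mod_cast h₂ (i + 1)) h₃
  have h10 := h₁ 0
  have h20 := h₂ 0
  simp only [Nat.cast_zero, sub_zero, add_zero] at h10 h20
  exact (Submodule.sub_mem_iff_right _ (Submodule.sub_mem _ h10 (Submodule.smul_mem _ _ h20))).1 h

/-- Expressing `a₍ₙ₎ b₍ₙ₎ v` through terms with spread-out indices. -/
lemma mode_mode_same_mem (hCFT : A.IsCFTType) (S : Submodule ℂ W) {p q : ℤ}
    {r : ℕ} {a b : V} (ha : a ∈ A.wtSpace p) (har : a ∈ twistSpace g r)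
    (hb : b ∈ A.wtSpace q) {n : ℚ} (hn : InCoset g r n) {v : W}
    (h₁ : ∀ i : ℕ, M.mode a (n - (i + 1)) (M.mode b (n + (i + 1)) v) ∈ S)
    (h₂ : ∀ i : ℕ, M.mode b (n - (i + 1)) (M.mode a (n + (i + 1)) v) ∈ S)
    (h₃ : ∀ i : ℕ, M.mode (A.mode a (i - 1) b) (2 * n + 1 - i) v ∈ S) :
    M.mode a n (M.mode b n v) ∈ S := by
  have hn1 : InCoset g r (n + 1) := by simpa using hn.add_int 1
  -- Using `n + 1` as the index of `a` makes `a₍ₙ₎ b₍ₙ₎` the leading term, while the terms in the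
  -- opposite order start at `b₍ₙ₋₁₎ a₍ₙ₊₁₎`, already spread.
  have h := M.jacobi_sub_mem hCFT S ha har hb v (-1) (n := n) hn1
    (fun _ i => by
      have e : ((-1 : ℤ) : ℚ) + (n + 1) - (i + 1) = n - (i + 1) := by push_cast; ring
      rw [e]; exact h₁ i)
    (fun _ i => by
      have e : ((-1 : ℤ) : ℚ) + n - (i + 1) = n - ((i + 1 : ℕ) + 1) := by push_cast; ring
      have e' : n + 1 + ((i : ℚ) + 1) = n + ((i + 1 : ℕ) + 1) := by push_cast; ring
      rw [e, e']; exact h₂ (i + 1))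
    (fun i => by
      have e : (-1 : ℤ) + (i + 1) = ((i + 1 : ℕ) : ℤ) - 1 := by push_cast; ring
      have e' : n + 1 + n - ((i : ℚ) + 1) = 2 * n + 1 - (i + 1 : ℕ) := by push_cast; ring
      rw [e, e']; exact h₃ (i + 1))
  have e1 : ((-1 : ℤ) : ℚ) + (n + 1) = n := by push_cast; ring
  have h20 := h₂ 0
  have h30 := h₃ 0
  rw [e1] at h
  have e2 : ((-1 : ℤ) : ℚ) + n = n - ((0 : ℕ) + 1) := by push_cast; ring
  have e3 : n + 1 = n + (((0 : ℕ) : ℚ) + 1) := by push_cast; ring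
  have e4 : n + 1 + n = 2 * n + 1 - ((0 : ℕ) : ℚ) := by push_cast; ring
  rw [e2, e4, e3] at h
  have h4 := (Submodule.sub_mem_iff_left _ (by simpa using h30)).1 h
  exact (Submodule.sub_mem_iff_left _ (S.smul_mem _ h20)).1 h4

lemma image_sub_image_mem (hCFT : A.IsCFTType) (hg : A.IsAutomorphism g)
    {X Y : List (ModeLetter V)} (h : X.Perm Y) (hX : IsMonomial A g X) :
    M.image w X - M.image w Y ∈ M.filtration w (degree X - 1) (weight X) := by
  induction h with
  | nil => simp
  | cons x h ih =>
    obtain ⟨⟨hx, r, hxr, hn⟩, hX⟩ := isMonomial_cons.1 hX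
    rw [image_cons, image_cons, ← map_sub]
    exact mode_mem_filtration hx hxr hn (ih hX) (by rw [degree_cons]; omega) (by simp)
  | swap x y l =>
    obtain ⟨⟨hy, s, hys, hm⟩, hX⟩ := isMonomial_cons.1 hX
    obtain ⟨⟨hx, r, hxr, hn⟩, hX⟩ := isMonomial_cons.1 hX
    exact commutator_mem_filtration hCFT hg hy hys hx hxr hm hn
      (image_mem_filtration hX le_rfl rfl) (by simp; omega) (by simp; ring)
  | trans h₁ h₂ ih₁ ih₂ =>
    have h := Submodule.add_mem _ (ih₁ hX)
      (by rw [degree_perm h₁, weight_perm h₁]; exact ih₂ (hX.perm h₁))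
    simpa using h

end WeakTwistedModule

/-! ### Combinatorics of the indices of a word -/

lemma List.exists_perm_of_not_pairwise {α : Type*} {R : α → α → Prop} {l : List α}
    (h : ¬ l.Pairwise R) : ∃ a b t, l.Perm (a :: b :: t) ∧ ¬ R a b := by
  induction l with
  | nil => exact absurd List.Pairwise.nil h
  | cons x l ih =>
    by_cases hl : l.Pairwise R
    · rw [List.pairwise_cons, not_and_or] at h
      have h := h.resolve_right (not_not.2 hl)
      push Not at h
      obtain ⟨y, hy, hxy⟩ := h
      obtain ⟨s, t, rfl⟩ := List.append_of_mem hy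
      exact ⟨x, y, s ++ t, List.Perm.cons x List.perm_middle, hxy⟩
    · obtain ⟨a, b, t, hp, hab⟩ := ih hl
      refine ⟨a, b, x :: t, (hp.cons x).trans ?_, hab⟩
      exact (List.Perm.swap a x _).trans ((List.Perm.swap b x t).cons a)

lemma List.sum_map_sq_le {α : Type*} (f : α → ℚ) {l : List α} (h : ∀ x ∈ l, 0 ≤ f x) :
    0 ≤ (l.map f).sum ∧ (l.map fun x => f x ^ 2).sum ≤ (l.map f).sum ^ 2 := by
  induction l with
  | nil => simp
  | cons x l ih =>
    obtain ⟨h1, h2⟩ := ih fun y hy => h y (List.mem_cons_of_mem _ hy)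
    have hx := h x List.mem_cons_self
    simp only [List.map_cons, List.sum_cons]
    exact ⟨add_nonneg hx h1, by nlinarith [mul_nonneg hx h1]⟩

namespace ModeLetter

variable {V : Type*}

/-- A measure of how far the indices of a word are from being spread out; it is nonnegative as long
as all indices are at most `T`. -/
def concentration (T : ℚ) (X : List (ModeLetter V)) : ℚ :=
  (X.map fun x => T - x.idx).sum ^ 2 - (X.map fun x => (T - x.idx) ^ 2).sum

lemma concentration_perm (T : ℚ) {X Y : List (ModeLetter V)} (h : X.Perm Y) :
    concentration T X = concentration T Y := by
  rw [concentration, concentration, (h.map _).sum_eq, (h.map fun x => (T - x.idx) ^ 2).sum_eq]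

lemma concentration_nonneg {T : ℚ} {X : List (ModeLetter V)} (h : ∀ x ∈ X, x.idx < T) :
    0 ≤ concentration T X :=
  sub_nonneg.2 (List.sum_map_sq_le _ fun x hx => (sub_pos.2 (h x hx)).le).2

/-- The sum of the indices is unchanged, while the sum of the squares grows by `2 * e ^ 2`. The
uniform drop allows induction over `ℕ` although indices are rational. -/
lemma concentration_spread (T : ℚ) (a b : V) (p q : ℤ) {n e : ℚ} (he : 1 ≤ e)
    (x y : ModeLetter V) (hx : x.idx = n) (hy : y.idx = n) (X : List (ModeLetter V)) :
    concentration T (⟨a, p, n - e⟩ :: ⟨b, q, n + e⟩ :: X) + 1 ≤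
      concentration T (x :: y :: X) := by
  simp only [concentration, List.map_cons, List.sum_cons, hx, hy]
  nlinarith

end ModeLetter

/-! ### Reduction to normal monomials -/

namespace WeakTwistedModule

open ModeLetter

variable {V : Type*} [AddCommGroup V] [Module ℂ V] {A : VertexOperatorAlgebra V}
  {g : V ≃ₗ[ℂ] V} {W : Type*} [AddCommGroup W] [Module ℂ W]
  {M : WeakTwistedModule A g W} {w : W}

/-- Innermost induction, with degree bound and length fixed: `n` bounds the concentration, and words
of lower degree or smaller length are assumed done. -/
lemma image_mem_normalSpan_of_letters_mem (hCFT : A.IsCFTType) (hg : A.IsAutomorphism g)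
    {U : Submodule ℂ V} {T : ℚ} (hT : M.VanishesFrom U w T) {d : ℤ} {k : ℕ}
    (hdeg : ∀ c, M.filtration w (d - 1) c ≤ M.normalSpan U T w d c)
    (hlen : ∀ X : List (ModeLetter V), IsMonomial A g X → X.length < k → degree X ≤ d →
      M.image w X ∈ M.normalSpan U T w d (weight X)) (n : ℕ) :
    ∀ X : List (ModeLetter V), IsMonomial A g X → (∀ x ∈ X, x.vec ∈ U) → X.length = k →
      degree X ≤ d → concentration T X < n →
      M.image w X ∈ M.normalSpan U T w d (weight X) := by
  have hperm : ∀ {X Y : List (ModeLetter V)}, X.Perm Y → IsMonomial A g X → degree X ≤ d →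
      M.image w Y ∈ M.normalSpan U T w d (weight Y) →
      M.image w X ∈ M.normalSpan U T w d (weight X) := by
    intro X Y h hX hd hY
    have h1 := hdeg _ (filtration_mono (by omega) _ (image_sub_image_mem (w := w) hCFT hg h hX))
    rw [← weight_perm h] at hY
    exact (Submodule.sub_mem_iff_left _ hY).1 h1
  have htail : ∀ X : List (ModeLetter V), IsMonomial A g X → (∀ x ∈ X, x.vec ∈ U) →
      degree X ≤ d → (¬ ∀ x ∈ X, x.idx < T) →
      M.image w X ∈ M.normalSpan U T w d (weight X) := by
    intro X hX hXU hd h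
    push Not at h
    obtain ⟨x, hx, hxT⟩ := h
    obtain ⟨s, t, rfl⟩ := List.append_of_mem hx
    -- The letter of index at least `T` is moved to the right end, where it annihilates `w`.
    have hp : (s ++ x :: t).Perm (s ++ t ++ [x]) := by
      rw [List.append_assoc]
      exact List.Perm.append_left s (List.perm_append_singleton x t).symm
    refine hperm hp hX hd ?_
    rw [image_append, image_cons]
    change M.image (M.mode x.vec x.idx w) _ ∈ _
    rw [hT _ (hXU x hx) _ hxT, image_eq, map_zero]
    exact Submodule.zero_mem _
  induction n with
  | zero =>
    intro X hX hXU hk hd hn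
    -- Negative concentration forces some index to be at least `T`.
    exact htail X hX hXU hd fun h => absurd (concentration_nonneg h) (by simpa using hn)
  | succ n ih =>
    intro X hX hXU hk hd hn
    by_cases h : ∀ x ∈ X, x.idx < T
    swap
    · exact htail X hX hXU hd h
    by_cases hne : X.Pairwise fun x y => x.idx ≠ y.idx
    · let Y := X.insertionSort fun x y => x.idx ≤ y.idx
      have hp : X.Perm Y := (List.perm_insertionSort _ X).symm
      have : Std.Total fun x y : ModeLetter V => x.idx ≤ y.idx := ⟨fun x y => le_total _ _⟩
      have : IsTrans (ModeLetter V) fun x y => x.idx ≤ y.idx := ⟨fun _ _ _ => le_trans⟩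
      have hle : Y.Pairwise fun x y => x.idx ≤ y.idx := List.pairwise_insertionSort _ X
      have hneY : Y.Pairwise fun x y => x.idx ≠ y.idx :=
        (hp.pairwise_iff fun h => h.symm).1 hne
      refine hperm hp hX hd (image_mem_normalSpan ⟨hX.perm hp, ?_, ?_, ?_⟩ ?_ rfl)
      · exact fun x hx => hXU x (hp.mem_iff.2 hx)
      · exact hle.imp₂ (fun _ _ h h' => lt_of_le_of_ne h h') hneY
      · exact fun x hx => h x (hp.mem_iff.2 hx)
      · rwa [← degree_perm hp]
    · obtain ⟨a, b, R, hp, hab⟩ := List.exists_perm_of_not_pairwise hne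
      simp only [ne_eq, not_not] at hab
      refine hperm hp hX hd ?_
      have hX' := hX.perm hp
      have hU' : ∀ x ∈ a :: b :: R, x.vec ∈ U := fun x hx => hXU x (hp.mem_iff.2 hx)
      have hk' := hp.length_eq.symm.trans hk
      have hd' : degree (a :: b :: R) ≤ d := degree_perm hp ▸ hd
      rw [concentration_perm T hp] at hn
      obtain ⟨⟨ha, r, har, hm⟩, hX'⟩ := isMonomial_cons.1 hX'
      obtain ⟨⟨hb, s, hbs, hm'⟩, hR⟩ := isMonomial_cons.1 hX'
      have hshift : ∀ {t : ℕ} {m : ℚ}, InCoset g t m → ∀ i : ℕ,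
          InCoset g t (m - (i + 1)) ∧ InCoset g t (m + (i + 1)) := by
        intro t m hm i
        constructor
        · convert hm.add_int (-(i + 1)) using 1; push_cast; ring
        · convert hm.add_int (i + 1) using 1; push_cast; ring
      have hUa := hU' a (by simp)
      have hUb := hU' b (by simp)
      have hUR : ∀ x ∈ R, x.vec ∈ U := fun x hx => hU' x (by simp [hx])
      have hspread : ∀ (x y : ModeLetter V), x.vec ∈ A.wtSpace x.wt → y.vec ∈ A.wtSpace y.wt →
          ∀ t u : ℕ, x.vec ∈ twistSpace g t → InCoset g t a.idx → y.vec ∈ twistSpace g u →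
          InCoset g u a.idx → x.vec ∈ U → y.vec ∈ U → x.wt + y.wt = a.wt + b.wt → ∀ i : ℕ,
          M.mode x.vec (a.idx - (i + 1)) (M.mode y.vec (a.idx + (i + 1)) (M.image w R)) ∈
            M.normalSpan U T w d (weight (a :: b :: R)) := by
        intro x y hx hy t u hxt hta hyu hua hxU hyU hxy i
        have h1 := ih (⟨x.vec, x.wt, a.idx - (i + 1)⟩ :: ⟨y.vec, y.wt, a.idx + (i + 1)⟩ :: R)
          (isMonomial_cons.2 ⟨⟨hx, t, hxt, (hshift hta i).1⟩,
            isMonomial_cons.2 ⟨⟨hy, u, hyu, (hshift hua i).2⟩, hR⟩⟩)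
          (by
            simp only [List.mem_cons]
            rintro z (rfl | rfl | hz)
            exacts [hxU, hyU, hUR z hz])
          (by simpa using hk')
          (by simp only [degree_cons] at hd' ⊢; omega)
          (by
            have := concentration_spread T x.vec y.vec x.wt y.wt (n := a.idx) (e := i + 1)
              (by linarith [Nat.cast_nonneg (α := ℚ) i]) a b rfl hab.symm R
            push_cast at hn
            linarith)
        have e : weight (⟨x.vec, x.wt, a.idx - (i + 1)⟩ :: ⟨y.vec, y.wt, a.idx + (i + 1)⟩ :: R) =
            weight (a :: b :: R) := by
          have hxy' : (x.wt : ℚ) + y.wt = a.wt + b.wt := by exact_mod_cast hxy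
          simp only [weight_cons, ← hab]
          linarith
        rwa [e] at h1
      have hm'a : InCoset g s a.idx := hab ▸ hm'
      rw [image_cons, image_cons, ← hab]
      refine mode_mode_same_mem hCFT _ ha har hb hm
        (hspread a b ha hb r s har hm hbs hm'a hUa hUb rfl)
        (hspread b a hb ha s r hbs hm'a har hm hUb hUa (add_comm _ _)) fun i => ?_
      have hc : InCoset g (r + s) (2 * a.idx + 1 - i) := by
        convert (hm.add hm'a).add_int (1 - i) using 1; push_cast; ring
      have hv := A.mode_mem_wtSpace ha hb (i - 1) rfl
      have ht := A.mode_mem_twistSpace hg har hbs (i - 1)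
      have e : (((a.wt + b.wt - ((i : ℤ) - 1) - 1 : ℤ) : ℚ) - (2 * a.idx + 1 - i) - 1) +
          weight R = weight (a :: b :: R) := by
        simp only [weight_cons, ← hab]; push_cast; ring
      simp only [degree_cons] at hd'
      -- For `i = 0` the degree is kept but the word is shorter; as `a₍₋₁₎ b` need not lie in `U`,
      -- `hlen` has to cover arbitrary letters. For `i > 0` the degree drops.
      rcases Nat.eq_zero_or_pos i with rfl | hi
      · have h1 := hlen (⟨A.mode a.vec ((0 : ℕ) - 1) b.vec, _, _⟩ :: R)
          (isMonomial_cons.2 ⟨⟨hv, _, ht, hc⟩, hR⟩) (by simp at hk' ⊢; omega)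
          (by simp only [degree_cons]; push_cast; omega)
        rw [weight_cons, e] at h1
        exact h1
      · refine hdeg _ (mode_mem_filtration hv ht hc (image_mem_filtration hR le_rfl rfl) ?_ e)
        omega

lemma image_mem_normalSpan_of_filtration_le (hCFT : A.IsCFTType) (hfin : IsOfFinOrder g)
    (hg : A.IsAutomorphism g) {U : Submodule ℂ V} (hU : IsGeneratingSpace A g U) {T : ℚ}
    (hT : M.VanishesFrom U w T) {d : ℤ}
    (hdeg : ∀ c, M.filtration w (d - 1) c ≤ M.normalSpan U T w d c) (k : ℕ) :
    ∀ X : List (ModeLetter V), IsMonomial A g X → X.length = k → degree X ≤ d →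
      M.image w X ∈ M.normalSpan U T w d (weight X) := by
  induction k using Nat.strong_induction_on with
  | _ k ihk =>
  -- The letters of `L` already lie in `U`; those of `R` are replaced one at a time, from left to
  -- right, modulo lower degree.
  have key : ∀ R L : List (ModeLetter V), IsMonomial A g (L ++ R) → (∀ x ∈ L, x.vec ∈ U) →
      (L ++ R).length = k → degree (L ++ R) ≤ d →
      M.image w (L ++ R) ∈ M.normalSpan U T w d (weight (L ++ R)) := by
    intro R
    induction R with
    | nil =>
      intro L hL hLU hk hd
      rw [List.append_nil] at *
      obtain ⟨n, hn⟩ := exists_nat_gt (concentration T L)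
      exact image_mem_normalSpan_of_letters_mem hCFT hg hT hdeg
        (fun X hX hlt hXd => ihk _ hlt X hX rfl hXd) n L hL hLU hk hd hn
    | cons x R ih =>
      intro L hLR hLU hk hd
      obtain ⟨hL, hxR⟩ := isMonomial_append.1 hLR
      obtain ⟨⟨hx, r, hxr, hm⟩, hR⟩ := isMonomial_cons.1 hxR
      obtain ⟨u, hu, c, hc, huc⟩ := Submodule.mem_sup.1
        (A.homogeneous_le_sup hfin hg hU x.wt r ⟨hx, hxr⟩)
      have e : M.image w (L ++ x :: R) = M.image w (L ++ [⟨u, x.wt, x.idx⟩] ++ R) +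
          M.image (M.mode c x.idx (M.image w R)) L := by
        rw [image_append, List.append_assoc, image_append, image_cons, ← huc, M.mode_add,
          List.singleton_append, image_cons, LinearMap.add_apply]
        simp only [M.image_eq _ L, map_add]
      rw [e]
      refine Submodule.add_mem _ ?_ (hdeg _ ?_)
      · have h1 := ih (L ++ [⟨u, x.wt, x.idx⟩])
          (by
            rw [List.append_assoc]
            exact isMonomial_append.2 ⟨hL, isMonomial_cons.2 ⟨⟨hu.2.1, r, hu.2.2, hm⟩, hR⟩⟩)
          (by
            intro y hy
            rcases List.mem_append.1 hy with hy | hy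
            · exact hLU y hy
            · rw [List.mem_singleton.1 hy]; exact hu.1)
          (by simpa [add_assoc, add_comm, add_left_comm] using hk)
          (by simpa [add_assoc] using hd)
        simpa [add_assoc] using h1
      · have h1 := mode_homogeneousC2_mem_filtration (M := M) (w := w) hCFT hfin hg hc hm
          (image_mem_filtration hR le_rfl rfl) le_rfl rfl
        have h2 := image_mem_filtration_of_mem hL h1
        simp only [degree_append, degree_cons] at hd
        simp only [weight_append, weight_cons]
        exact filtration_mono (by omega) _ h2
  intro X hX hk hd
  exact key X [] hX (by simp) hk hd

/-- A word of negative degree has a letter of negative weight, whose vector is zero. -/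
lemma filtration_eq_bot (hCFT : A.IsCFTType) {d : ℤ} (hd : d < 0) (c : ℚ) :
    M.filtration w d c = ⊥ := by
  refine (Submodule.span_eq_bot).2 ?_
  rintro _ ⟨X, hX, hXd, -, rfl⟩
  have hneg : degree X < 0 := by omega
  clear hXd
  induction X with
  | nil => simp at hneg
  | cons x X ih =>
    obtain ⟨⟨hx, -⟩, hX⟩ := isMonomial_cons.1 hX
    rw [degree_cons] at hneg
    rw [image_cons]
    by_cases hwt : x.wt < 0
    · rw [A.eq_zero_of_wt_neg hCFT hwt hx, M.mode_zero]; rfl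
    · rw [ih hX (by omega), map_zero]

lemma filtration_le_normalSpan (hCFT : A.IsCFTType) (hfin : IsOfFinOrder g)
    (hg : A.IsAutomorphism g) {U : Submodule ℂ V} (hU : IsGeneratingSpace A g U) {T : ℚ}
    (hT : M.VanishesFrom U w T) (d : ℤ) (c : ℚ) :
    M.filtration w d c ≤ M.normalSpan U T w d c := by
  -- The shift by one starts the induction at degree `-1`, where the filtration vanishes.
  have key : ∀ (n : ℕ) (c : ℚ), M.filtration w (n - 1) c ≤ M.normalSpan U T w (n - 1) c := by
    intro n
    induction n with
    | zero => intro c; rw [filtration_eq_bot hCFT (by simp)]; exact bot_le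
    | succ n ih =>
      intro c
      refine Submodule.span_le.2 ?_
      rintro _ ⟨X, hX, hXd, rfl, rfl⟩
      refine image_mem_normalSpan_of_filtration_le hCFT hfin hg hU hT (fun c => ?_) _ X hX rfl hXd
      have h1 : (((n + 1 : ℕ) : ℤ) - 1 - 1) = n - 1 := by push_cast; ring
      rw [h1]
      exact (ih c).trans (normalSpan_mono (by push_cast; omega) c)
  rcases lt_or_ge d 0 with hd | hd
  · rw [filtration_eq_bot hCFT hd]; exact bot_le
  · obtain ⟨n, rfl⟩ := Int.eq_ofNat_of_zero_le hd
    simpa using key (n + 1) c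

lemma exists_vanishesFrom (hfin : IsOfFinOrder g) (M : WeakTwistedModule A g W) (w : W)
    {U : Submodule ℂ V} (hU : FiniteDimensional ℂ U) :
    ∃ k : ℕ, M.VanishesFrom U w ((k : ℚ) / (orderOf g : ℚ)) := by
  classical
  obtain ⟨t, rfl⟩ := (Submodule.fg_iff_finiteDimensional U).2 hU
  choose n₀ hn₀ using fun a => M.truncation a w
  obtain ⟨B, hB⟩ := (t.image n₀).exists_le
  have hD : (0 : ℚ) < orderOf g := by exact_mod_cast hfin.orderOf_pos
  obtain ⟨k, hk⟩ := exists_nat_ge (B * orderOf g)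
  refine ⟨k, fun β hβ m hm => ?_⟩
  refine (Submodule.span_le (p := LinearMap.ker (M.modeHom m w))).2 (fun a ha => ?_) hβ
  refine hn₀ a m ((hB _ (Finset.mem_image_of_mem _ ha)).trans ?_)
  exact ((le_div_iff₀ hD).2 hk).trans hm

lemma orbit_le_span_normal (hCFT : A.IsCFTType) (hfin : IsOfFinOrder g)
    (hg : A.IsAutomorphism g) {U : Submodule ℂ V} (hU : IsGeneratingSpace A g U) {T : ℚ}
    (hT : M.VanishesFrom U w T) :
    M.orbit w ≤ Submodule.span ℂ
      {v : W | ∃ Z : List (ModeLetter V), IsNormal A g U T Z ∧ v = M.image w Z} := by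
  have hS : ∀ d c, M.filtration w d c ≤ Submodule.span ℂ
      {v : W | ∃ Z : List (ModeLetter V), IsNormal A g U T Z ∧ v = M.image w Z} := fun d c =>
    (filtration_le_normalSpan hCFT hfin hg hU hT d c).trans
      (Submodule.span_mono fun v ⟨Z, hZ, _, _, hv⟩ => ⟨Z, hZ, hv⟩)
  generalize Submodule.span ℂ
    {v : W | ∃ Z : List (ModeLetter V), IsNormal A g U T Z ∧ v = M.image w Z} = S at hS ⊢
  refine Submodule.span_le.2 ?_
  rintro _ ⟨a, n, rfl⟩
  have ha : a ∈ Submodule.span ℂ (A.homogeneousSet g) := by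
    rw [A.span_homogeneousSet hfin hg]; exact Submodule.mem_top
  refine (Submodule.span_le (p := S.comap (M.modeHom n w))).2 ?_ ha
  intro b hb
  obtain ⟨p, r, hbp, hbr⟩ : ∃ p r, b ∈ A.homogeneous g p r := hb
  change M.mode b n w ∈ S
  -- Inside the coset, `b₍ₙ₎ w` is the image of a one-letter monomial; outside it, the mode is zero.
  by_cases hn : InCoset g r n
  · have hX : IsMonomial A g [(⟨b, p, n⟩ : ModeLetter V)] := by
      intro x hx
      rw [List.mem_singleton.1 hx]
      exact ⟨hbp, r, hbr, hn⟩
    have h1 : M.image w [⟨b, p, n⟩] ∈ M.filtration w p (p - n - 1) :=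
      image_mem_filtration hX (by simp) (by simp)
    exact hS _ _ h1
  · have : M.mode b n = 0 := M.mode_eq_zero r b hbr n hn
    rw [this]
    exact Submodule.zero_mem _

end WeakTwistedModule

end

theorem mainTheorem3 {V : Type*} [AddCommGroup V] [Module ℂ V]
    (A : VertexOperatorAlgebra V) (hC2 : A.IsC2Cofinite) (hCFT : A.IsCFTType)
    (g : V ≃ₗ[ℂ] V) (hg : A.IsAutomorphism g) (hfin : IsOfFinOrder g)
    {W : Type*} [AddCommGroup W] [Module ℂ W]
    (M : WeakTwistedModule A g W) (w : W) (hw : M.orbit w = ⊤) :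
    (∃ U : Submodule ℂ V, IsGeneratingSpace A g U) ∧
    ∀ U : Submodule ℂ V, IsGeneratingSpace A g U →
      (∃ k : ℕ, M.VanishesFrom U w ((k : ℚ) / (orderOf g : ℚ))) ∧
      ∀ T : ℚ, (∃ k : ℤ, T = (k : ℚ) / (orderOf g : ℚ)) → M.VanishesFrom U w T →
        (∀ X : List (ModeLetter V), ModeLetter.IsMonomial A g X →
          M.image w X ∈ Submodule.span ℂ
            {v : W | ∃ Z : List (ModeLetter V), ModeLetter.IsNormal A g U T Z ∧
              ModeLetter.degree Z ≤ ModeLetter.degree X ∧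
              ModeLetter.weight Z = ModeLetter.weight X ∧ v = M.image w Z}) ∧
        Submodule.span ℂ
            {v : W | ∃ Z : List (ModeLetter V),
              ModeLetter.IsNormal A g U T Z ∧ v = M.image w Z} = ⊤ := by
  refine ⟨A.exists_isGeneratingSpace hC2 hg hfin, fun U hU =>
    ⟨M.exists_vanishesFrom hfin w hU.finite, fun T _ hT => ⟨fun X hX => ?_, ?_⟩⟩⟩
  · exact WeakTwistedModule.filtration_le_normalSpan hCFT hfin hg hU hT _ _
      (WeakTwistedModule.image_mem_filtration hX le_rfl rfl)
  · exact top_le_iff.1 (hw.ge.trans <| WeakTwistedModule.orbit_le_span_normal hCFT hfin hg hU hT)
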